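/- Let $n,m\in\mathbb N$ (with $m=0$ allowed), $a\in\mathbb R$, and let $S\subset\mathbb R^n_+=[0,\infty)^n$ be compact and convex with $0\in S$. Write $\mathbb C^{*n}=(\mathbb C\setminus\{0\})^n$ and $\operatorname{Log} z=(\log|z_1|,\dots,\log|z_n|)$ for $z\in\mathbb C^{*n}$, let $\varphi_S(\xi)=\sup_{s\in S}\langle s,\xi\rangle$ for $\xi\in\mathbb R^n$, and define $H_S:\mathbb C^n\to\mathbb R$ by $H_S(z)=\varphi_S(\operatorname{Log} z)$ for $z\in\mathbb C^{*n}$ and $H_S(z)=\limsup_{\mathbb C^{*n}\ni w\to z}H_S(w)$ for $z\in\mathbb C^n\setminus\mathbb C^{*n}$. Put $\nu(z)=\langle\mathbf 1,\operatorname{Log} z\rangle=\sum_{j}\log|z_j|$ for $z\in\mathbb C^{*n}$, let $|z|$ be the Euclidean norm and $\lambda$ the Lebesgue measure on $\mathbb C^n$. Let $u\in C^1(\mathbb C^n)$ be a complex-valued function (continuously differentiable in the real sense) such that $\bar\partial u=\sum_j \frac{\partial u}{\partial\bar z_j}\,d\bar z_j$ has compact support. If $$\int_{\mathbb C^n}|u(z)|^2(1+|z|^2)^{-a}e^{-2mH_S(z)-2\nu(z)}\,d\lambda(z)<+\infty,$$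 then there exists a constant $C>0$ such that $$|u(z)|\le C(1+|z|)^a e^{mH_S(z)}\qquad\text{for all } z\in\mathbb C^n.$$ (The integrand is defined on $\mathbb C^{*n}$, whose complement is $\lambda$-null when $n\ge 1$.) -/

import Mathlib

open scoped Topology

noncomputable section

namespace LogSupport

/-- `ℂ*ⁿ`: the points of `ℂⁿ` all of whose coordinates are nonzero. -/
def cstar (n : ℕ) : Set (EuclideanSpace ℂ (Fin n)) := {z | ∀ j, z j ≠ 0}

/-- `Log z = (log |z₁|, …, log |zₙ|)`, meaningful for `z ∈ ℂ*ⁿ`. -/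
def Log {n : ℕ} (z : EuclideanSpace ℂ (Fin n)) : EuclideanSpace ℝ (Fin n) :=
  WithLp.toLp 2 fun j => Real.log ‖z j‖

/-- The supporting function `φ_S(ξ) = sup_{s ∈ S} ⟨s, ξ⟩`; a genuine supremum when `S` is
nonempty and compact. -/
def suppFun {n : ℕ} (S : Set (EuclideanSpace ℝ (Fin n))) (ξ : EuclideanSpace ℝ (Fin n)) : ℝ :=
  sSup ((fun s => inner ℝ s ξ) '' S)

open scoped Classical in
/-- The logarithmic supporting function `H_S`: it is `φ_S(Log z)` on `ℂ*ⁿ`, extended to the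
coordinate hyperplanes by the upper limit along `ℂ*ⁿ`. For compact `S ⊆ ℝ₊ⁿ` containing `0`,
`φ_S ∘ Log` is nonnegative and locally bounded above at every point of `ℂⁿ`, so the
real-valued upper limit is the usual one. -/
def logSuppFun {n : ℕ} (S : Set (EuclideanSpace ℝ (Fin n))) (z : EuclideanSpace ℂ (Fin n)) : ℝ :=
  if z ∈ cstar n then suppFun S (Log z)
  else Filter.limsup (fun w => suppFun S (Log w)) (𝓝[cstar n] z)

/-- `ν(z) = ⟨𝟏, Log z⟩`, with `𝟏 = (1, …, 1)`, meaningful for `z ∈ ℂ*ⁿ`. -/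
def nu {n : ℕ} (z : EuclideanSpace ℂ (Fin n)) : ℝ :=
  inner ℝ (WithLp.toLp 2 fun _ => (1 : ℝ)) (Log z)

/-- `∂̄u`, the (0,1)-form `∑ⱼ (∂u/∂z̄ⱼ) dz̄ⱼ` given by its coefficients
`∂u/∂z̄ⱼ = (∂u/∂xⱼ + i ∂u/∂yⱼ) / 2`. -/
def dbar {n : ℕ} (u : EuclideanSpace ℂ (Fin n) → ℂ) (z : EuclideanSpace ℂ (Fin n)) :
    Fin n → ℂ := fun j =>
  (fderiv ℝ u z (EuclideanSpace.single j 1)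
    + Complex.I * fderiv ℝ u z (EuclideanSpace.single j Complex.I)) / 2

end LogSupport

end

/-!
Outside a compact set `u` is holomorphic. For `z ∈ ℂ*ⁿ` far from the origin, the mean value
inequality for `|u|²` is applied on the image of the ball `B(𝟏, 1/2)` under the linear map
`ζ ↦ (z₁ζ₁, …, zₙζₙ)`, whose real Jacobian is `|z₁ ⋯ zₙ|² = e^{2ν(z)}`; this factor is exactly
what cancels `e^{-2ν}` in the `L²` hypothesis. On that image `Log` stays within bounded distance
of `Log z`, and `φ_S` is Lipschitz, so the weight is comparable to its value at `z`. Near the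
origin the bound follows from continuity of `u` and boundedness of `H_S`. Finally the bound passes
from `ℂ*ⁿ` to the coordinate hyperplanes because `H_S(z)` is a cluster value of `φ_S ∘ Log` along
`ℂ*ⁿ`.
-/

open MeasureTheory Metric Set Filter
open scoped ENNReal NNReal

namespace LogSupport

section MeanValue

variable {E : Type*} [NormedAddCommGroup E] [NormedSpace ℂ E] [FiniteDimensional ℂ E]
  [MeasurableSpace E] [BorelSpace E] (μ : Measure E) [μ.IsAddHaarMeasure]

theorem lintegral_image_eq_lintegral_enorm_det_sq_mul {s : Set E} (hs : MeasurableSet s)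
    {φ : E → E} {φ' : E → E →L[ℂ] E} (hφ : ∀ x ∈ s, HasFDerivWithinAt φ (φ' x) s x)
    (hinj : InjOn φ s) (g : E → ℝ≥0∞) :
    ∫⁻ x in φ '' s, g x ∂μ = ∫⁻ x in s, ‖(φ' x).det‖ₑ ^ 2 * g (φ x) ∂μ := by
  have : FiniteDimensional ℝ E := FiniteDimensional.complexToReal E
  have hdet (L : E →L[ℂ] E) :
      ENNReal.ofReal |(L.restrictScalars ℝ).det| = ‖L.det‖ₑ ^ 2 := by
    have h : (L.restrictScalars ℝ).det = ‖L.det‖ ^ 2 := by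
      simp [ContinuousLinearMap.det, LinearMap.det_restrictScalars, Algebra.norm_complex_apply,
        Complex.normSq_eq_norm_sq]
    rw [h, abs_of_nonneg (sq_nonneg _), ENNReal.ofReal_pow (norm_nonneg _), ofReal_norm]
  simpa only [hdet] using lintegral_image_eq_lintegral_abs_det_fderiv_mul μ hs
    (fun x hx => (hφ x hx).restrictScalars ℝ) hinj g

theorem setLIntegral_ball_comp_homothety {t : ℂ} (ht : ‖t‖ = 1) (c : E) (r : ℝ) (g : E → ℝ≥0∞) :
    ∫⁻ x in ball c r, g (AffineMap.homothety c t x) ∂μ = ∫⁻ x in ball c r, g x ∂μ := by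
  have ht₀ : t ≠ 0 := norm_ne_zero_iff.1 (ht ▸ one_ne_zero)
  have hmaps {s : ℂ} (hs : ‖s‖ = 1) :
      MapsTo (AffineMap.homothety c s) (ball c r) (ball c r) := fun x hx => by
    simpa [hs, dist_comm c x] using hx
  have hbij : BijOn (AffineMap.homothety c t) (ball c r) (ball c r) := by
    refine InvOn.bijOn (f' := AffineMap.homothety c t⁻¹) ⟨fun x _ => ?_, fun x _ => ?_⟩
      (hmaps ht) (hmaps (by simp [ht]))
    · simp [← AffineMap.homothety_mul_apply, ht₀]
    · simp [← AffineMap.homothety_mul_apply, ht₀]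
  have hderiv : ∀ x ∈ ball c r, HasFDerivWithinAt (AffineMap.homothety c t)
      (t • ContinuousLinearMap.id ℂ E) (ball c r) x := fun x _ =>
    ((((hasFDerivAt_id x).sub_const c).const_smul t).add_const c).hasFDerivWithinAt
  have h := lintegral_image_eq_lintegral_enorm_det_sq_mul μ measurableSet_ball hderiv hbij.injOn g
  have hdet : ‖(t • ContinuousLinearMap.id ℂ E).det‖ₑ = 1 := by
    simp [ContinuousLinearMap.det, ← ofReal_norm, ht]
  simpa [hbij.image_eq, hdet] using h.symm

variable {F : Type*} [NormedAddCommGroup F] [NormedSpace ℂ F] [CompleteSpace F]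

theorem ofReal_two_pi_mul_enorm_le_lintegral_circleMap {f : ℂ → F} {c : ℂ} {R : ℝ}
    (hf : DiffContOnCl ℂ f (ball c |R|)) :
    ENNReal.ofReal (2 * Real.pi) * ‖f c‖ₑ
      ≤ ∫⁻ θ in Ioc 0 (2 * Real.pi), ‖f (circleMap c R θ)‖ₑ := by
  have hmean : (2 * Real.pi) • f c = ∫ θ in Ioc 0 (2 * Real.pi), f (circleMap c R θ) := by
    rw [← hf.circleAverage, Real.circleAverage_def,
      intervalIntegral.integral_of_le Real.two_pi_pos.le, smul_inv_smul₀ Real.two_pi_pos.ne']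
  calc ENNReal.ofReal (2 * Real.pi) * ‖f c‖ₑ = ‖(2 * Real.pi) • f c‖ₑ := by
        rw [enorm_smul, Real.enorm_eq_ofReal Real.two_pi_pos.le]
    _ ≤ _ := hmean ▸ enorm_integral_le_lintegral_enorm _

theorem enorm_mul_measure_ball_le_lintegral {f : E → F} {c : E} {r : ℝ}
    (hf : DifferentiableOn ℂ f (ball c r)) :
    ‖f c‖ₑ * μ (ball c r) ≤ ∫⁻ x in ball c r, ‖f x‖ₑ ∂μ := by
  have : ProperSpace E := FiniteDimensional.proper ℂ E
  -- Average the one-variable inequality for `t ↦ f (c + t (x - c))` on the unit circle over all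
  -- `x` in the ball, which the rotations `x ↦ c + e^{iθ} (x - c)` map to itself preserving `μ`.
  let rot (θ : ℝ) : E → E := AffineMap.homothety c (circleMap 0 1 θ)
  have hmaps {t : ℂ} (ht : ‖t‖ ≤ 1) {x : E} (hx : x ∈ ball c r) :
      AffineMap.homothety c t x ∈ ball c r := by
    rw [mem_ball, dist_homothety_center, dist_comm]
    exact (mul_le_of_le_one_left dist_nonneg ht).trans_lt hx
  have hcircle (x) (hx : x ∈ ball c r) :
      ENNReal.ofReal (2 * Real.pi) * ‖f c‖ₑ ≤ ∫⁻ θ in Ioc 0 (2 * Real.pi), ‖f (rot θ x)‖ₑ := by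
    let g (t : ℂ) : F := f (AffineMap.homothety c t x)
    have hdisc : DifferentiableOn ℂ g (closedBall 0 1) := by
      refine hf.comp (Differentiable.differentiableOn ?_) fun t ht =>
        hmaps (mem_closedBall_zero_iff.1 ht) hx
      simp only [AffineMap.homothety_apply, vsub_eq_sub, vadd_eq_add]
      fun_prop
    simpa [g] using ofReal_two_pi_mul_enorm_le_lintegral_circleMap (f := g) (c := 0) (R := 1)
      (by simpa using hdisc.diffContOnCl_ball subset_rfl)
  have hmeas : AEMeasurable (Function.uncurry fun x θ => ‖f (rot θ x)‖ₑ)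
      ((μ.restrict (ball c r)).prod (volume.restrict (Ioc 0 (2 * Real.pi)))) := by
    rw [Measure.prod_restrict]
    refine ContinuousOn.aemeasurable (continuous_enorm.comp_continuousOn
      (hf.continuousOn.comp (Continuous.continuousOn ?_) fun p hp => hmaps (by simp) hp.1))
      (measurableSet_ball.prod measurableSet_Ioc)
    simp only [rot, AffineMap.homothety_apply, vsub_eq_sub, vadd_eq_add, circleMap]
    fun_prop
  refine (ENNReal.mul_le_mul_iff_right (a := ENNReal.ofReal (2 * Real.pi))
    (by simp [Real.pi_pos]) ENNReal.ofReal_ne_top).1 ?_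
  calc ENNReal.ofReal (2 * Real.pi) * (‖f c‖ₑ * μ (ball c r))
      = ∫⁻ _ in ball c r, ENNReal.ofReal (2 * Real.pi) * ‖f c‖ₑ ∂μ := by
        rw [setLIntegral_const, mul_assoc]
    _ ≤ ∫⁻ x in ball c r, (∫⁻ θ in Ioc 0 (2 * Real.pi), ‖f (rot θ x)‖ₑ) ∂μ :=
        setLIntegral_mono' measurableSet_ball hcircle
    _ = ∫⁻ θ in Ioc 0 (2 * Real.pi), (∫⁻ x in ball c r, ‖f (rot θ x)‖ₑ ∂μ) :=
        lintegral_lintegral_swap hmeas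
    _ = ∫⁻ _ in Ioc 0 (2 * Real.pi), (∫⁻ x in ball c r, ‖f x‖ₑ ∂μ) :=
        lintegral_congr fun θ =>
          setLIntegral_ball_comp_homothety μ (by simp) c r fun x => ‖f x‖ₑ
    _ = ENNReal.ofReal (2 * Real.pi) * ∫⁻ x in ball c r, ‖f x‖ₑ ∂μ := by
        rw [setLIntegral_const, Real.volume_Ioc, sub_zero, mul_comm]

theorem enorm_sq_mul_measure_ball_le_lintegral {f : E → ℂ} {c : E} {r : ℝ}
    (hf : DifferentiableOn ℂ f (ball c r)) :
    ‖f c‖ₑ ^ 2 * μ (ball c r) ≤ ∫⁻ x in ball c r, ‖f x‖ₑ ^ 2 ∂μ := by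
  simpa using enorm_mul_measure_ball_le_lintegral μ (hf.pow 2)

end MeanValue

variable {n : ℕ}

section CauchyRiemann

variable {u : EuclideanSpace ℂ (Fin n) → ℂ} {z : EuclideanSpace ℂ (Fin n)}

theorem fderiv_single_eq_mul_of_dbar_eq_zero (h : dbar u z = 0) (j : Fin n) (c : ℂ) :
    fderiv ℝ u z (EuclideanSpace.single j c)
      = c * fderiv ℝ u z (EuclideanSpace.single j 1) := by
  let ℓ : ℂ →ₗ[ℝ] ℂ := (fderiv ℝ u z : EuclideanSpace ℂ (Fin n) →ₗ[ℝ] ℂ) ∘ₗ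
    (WithLp.linearEquiv 2 ℝ (Fin n → ℂ)).symm ∘ₗ LinearMap.single ℝ (fun _ => ℂ) j
  have hℓ (c : ℂ) : ℓ c = fderiv ℝ u z (EuclideanSpace.single j c) := rfl
  have hj : (ℓ 1 + Complex.I * ℓ Complex.I) / 2 = 0 := congrFun h j
  have hI : ℓ Complex.I = Complex.I • ℓ 1 := by
    rw [smul_eq_mul]
    linear_combination (-2 * Complex.I) * hj + ℓ Complex.I * Complex.I_sq
  simpa [hℓ] using real_linearMap_map_smul_complex hI c 1

theorem differentiableAt_of_dbar_eq_zero (hu : DifferentiableAt ℝ u z) (h : dbar u z = 0) :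
    DifferentiableAt ℂ u z := by
  refine (differentiableAt_iff_restrictScalars ℝ hu).2
    ⟨∑ j, fderiv ℝ u z (EuclideanSpace.single j 1) • EuclideanSpace.proj j, ?_⟩
  ext v
  have hv : ∑ j, EuclideanSpace.single j (v j) = v := by
    ext i
    simp [Pi.single_apply]
  conv_rhs => rw [← hv, map_sum]
  simp [fun j => fderiv_single_eq_mul_of_dbar_eq_zero h j (v j), mul_comm]

theorem eventually_differentiableAt_of_hasCompactSupport_dbar (hu : Differentiable ℝ u)
    (h : HasCompactSupport (dbar u)) :
    ∀ᶠ z in cocompact (EuclideanSpace ℂ (Fin n)), DifferentiableAt ℂ u z := by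
  filter_upwards [h.isCompact.compl_mem_cocompact] with z hz
  exact differentiableAt_of_dbar_eq_zero (hu z) (image_eq_zero_of_notMem_tsupport hz)

end CauchyRiemann

section SuppFun

variable {S : Set (EuclideanSpace ℝ (Fin n))}

theorem bddAbove_image_inner (hS : Bornology.IsBounded S) (ξ : EuclideanSpace ℝ (Fin n)) :
    BddAbove ((fun s => inner ℝ s ξ) '' S) := by
  obtain ⟨M, hM⟩ := hS.exists_norm_le
  refine ⟨M * ‖ξ‖, forall_mem_image.2 fun s hs => (real_inner_le_norm s ξ).trans ?_⟩
  gcongr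
  exact hM s hs

theorem inner_le_suppFun (hS : Bornology.IsBounded S) {s : EuclideanSpace ℝ (Fin n)} (hs : s ∈ S)
    (ξ : EuclideanSpace ℝ (Fin n)) : inner ℝ s ξ ≤ suppFun S ξ :=
  le_csSup (bddAbove_image_inner hS ξ) (mem_image_of_mem _ hs)

theorem suppFun_nonneg (hS : Bornology.IsBounded S) (h₀ : 0 ∈ S)
    (ξ : EuclideanSpace ℝ (Fin n)) : 0 ≤ suppFun S ξ := by
  simpa using inner_le_suppFun hS h₀ ξ

theorem lipschitzWith_suppFun {M : ℝ≥0} (hM : ∀ s ∈ S, ‖s‖ ≤ M) :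
    LipschitzWith M (suppFun S) := by
  rcases S.eq_empty_or_nonempty with rfl | hne
  · exact LipschitzWith.of_le_add_mul M fun ξ η => by simpa [suppFun] using by positivity
  refine LipschitzWith.of_le_add_mul M fun ξ η =>
    csSup_le (hne.image _) (forall_mem_image.2 fun s hs => ?_)
  have hS : Bornology.IsBounded S := isBounded_iff_forall_norm_le.2 ⟨M, hM⟩
  calc inner ℝ s ξ = inner ℝ s η + inner ℝ s (ξ - η) := by rw [inner_sub_right]; ring
    _ ≤ suppFun S η + ‖s‖ * ‖ξ - η‖ :=
        add_le_add (inner_le_suppFun hS hs η) (real_inner_le_norm _ _)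
    _ ≤ suppFun S η + M * dist ξ η := by
        rw [dist_eq_norm]
        gcongr
        exact hM s hs

theorem suppFun_le_suppFun (hS : Bornology.IsBounded S) (hS₀ : ∀ s ∈ S, ∀ j, 0 ≤ s j)
    {ξ η : EuclideanSpace ℝ (Fin n)} (h : ∀ j, ξ j ≤ η j) : suppFun S ξ ≤ suppFun S η := by
  rcases S.eq_empty_or_nonempty with rfl | hne
  · simp [suppFun]
  refine csSup_le (hne.image _) (forall_mem_image.2 fun s hs => ?_)
  refine le_trans ?_ (inner_le_suppFun hS hs η)
  simp only [PiLp.inner_apply, RCLike.inner_apply, conj_trivial]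
  exact Finset.sum_le_sum fun j _ => mul_le_mul_of_nonneg_right (h j) (hS₀ s hs j)

end SuppFun

section LogSuppFun

theorem dense_cstar (n : ℕ) : Dense (cstar n) := by
  have h : Dense (univ.pi fun _ : Fin n => ({0}ᶜ : Set ℂ)) :=
    dense_pi _ fun _ _ => dense_compl_singleton 0
  convert h.preimage (PiLp.homeomorph 2 fun _ : Fin n => ℂ).isOpenMap
  ext z
  simp [cstar, PiLp.homeomorph]

variable {S : Set (EuclideanSpace ℝ (Fin n))} {z : EuclideanSpace ℂ (Fin n)}

theorem logSuppFun_of_mem_cstar (hz : z ∈ cstar n) : logSuppFun S z = suppFun S (Log z) :=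
  if_pos hz

theorem suppFun_Log_le_of_norm_le (hS : Bornology.IsBounded S) (hS₀ : ∀ s ∈ S, ∀ j, 0 ≤ s j)
    (hz : z ∈ cstar n) {R : ℝ} (hzR : ‖z‖ ≤ R) :
    suppFun S (Log z) ≤ suppFun S (WithLp.toLp 2 fun _ => Real.log R) :=
  suppFun_le_suppFun hS hS₀ fun j =>
    Real.log_le_log (norm_pos_iff.2 (hz j)) ((PiLp.norm_apply_le z j).trans hzR)

theorem mapClusterPt_logSuppFun (hS : Bornology.IsBounded S) (hS₀ : ∀ s ∈ S, ∀ j, 0 ≤ s j)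
    (h₀ : 0 ∈ S) (z : EuclideanSpace ℂ (Fin n)) :
    MapClusterPt (logSuppFun S z) (𝓝[cstar n] z) fun w => suppFun S (Log w) := by
  by_cases hz : z ∈ cstar n
  · rw [logSuppFun_of_mem_cstar hz]
    exact (tendsto_pure_nhds (fun w => suppFun S (Log w)) z).mapClusterPt.mono
      (pure_le_nhdsWithin hz)
  have : (𝓝[cstar n] z).NeBot := mem_closure_iff_nhdsWithin_neBot.1 (dense_cstar n z)
  have hnorm : ∀ᶠ w in 𝓝[cstar n] z, ‖w‖ ≤ ‖z‖ + 1 := nhdsWithin_le_nhds <|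
    continuous_norm.continuousAt.eventually_le_const (lt_add_one ‖z‖)
  have hbdd : IsBoundedUnder (· ≤ ·) (𝓝[cstar n] z) fun w => suppFun S (Log w) :=
    isBoundedUnder_of_eventually_le <| by
      filter_upwards [hnorm, self_mem_nhdsWithin] with w hw hwc
      exact suppFun_Log_le_of_norm_le hS hS₀ hwc hw
  have hcobdd : IsCoboundedUnder (· ≤ ·) (𝓝[cstar n] z) fun w => suppFun S (Log w) :=
    isCoboundedUnder_le_of_le _ fun w => suppFun_nonneg hS h₀ (Log w)
  rw [logSuppFun, if_neg hz]
  exact MapClusterPt.limsup hcobdd hbdd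

end LogSuppFun

section MulBall

/-- The vector `𝟏 = (1, …, 1)`. -/
def ones (𝕜 : Type*) [RCLike 𝕜] (n : ℕ) : EuclideanSpace 𝕜 (Fin n) := WithLp.toLp 2 fun _ => 1

/-- Coordinatewise multiplication `ζ ↦ (z₁ζ₁, …, zₙζₙ)`. -/
noncomputable def coordMul (z : EuclideanSpace ℂ (Fin n)) :
    EuclideanSpace ℂ (Fin n) →L[ℂ] EuclideanSpace ℂ (Fin n) :=
  Matrix.toEuclideanCLM (𝕜 := ℂ) (Matrix.diagonal z)

/-- The multiplicative neighbourhood `{(z₁ζ₁, …, zₙζₙ) : |ζ - 𝟏| < 1/2}` of `z`. The radius `1/2`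
keeps `|ζⱼ|` between `1/2` and `2`, so that `Log` stays within bounded distance of `Log z`. -/
def mulBall (z : EuclideanSpace ℂ (Fin n)) : Set (EuclideanSpace ℂ (Fin n)) :=
  coordMul z '' ball (ones ℂ n) (1 / 2)

variable {z w : EuclideanSpace ℂ (Fin n)}

@[simp]
theorem coordMul_apply (z ζ : EuclideanSpace ℂ (Fin n)) (j : Fin n) :
    coordMul z ζ j = z j * ζ j := by
  simp [coordMul, Matrix.mulVec_diagonal]

theorem coordMul_ones (z : EuclideanSpace ℂ (Fin n)) : coordMul z (ones ℂ n) = z := by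
  ext j
  simp [ones]

theorem coordMul_injective (hz : z ∈ cstar n) : Function.Injective (coordMul z) := fun ζ ξ h => by
  ext j
  simpa [hz j] using congrArg (fun v : EuclideanSpace ℂ (Fin n) => v j) h

theorem det_coordMul (z : EuclideanSpace ℂ (Fin n)) : (coordMul z).det = ∏ j, z j := by
  rw [ContinuousLinearMap.det, coordMul, Matrix.coe_toEuclideanCLM_eq_toEuclideanLin,
    Matrix.toEuclideanLin_eq_toLin_orthonormal, LinearMap.det_toLin, Matrix.det_diagonal]

theorem nu_eq_sum (z : EuclideanSpace ℂ (Fin n)) : nu z = ∑ j, Real.log ‖z j‖ := by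
  simp [nu, Log, PiLp.inner_apply]

theorem norm_det_coordMul (hz : z ∈ cstar n) : ‖(coordMul z).det‖ = Real.exp (nu z) := by
  rw [det_coordMul, norm_prod, nu_eq_sum, Real.exp_sum]
  exact Finset.prod_congr rfl fun j _ => (Real.exp_log (norm_pos_iff.2 (hz j))).symm

theorem norm_apply_le_of_mem_mulBall (hw : w ∈ mulBall z) (j : Fin n) :
    ‖w j‖ ≤ 2 * ‖z j‖ ∧ ‖z j‖ ≤ 2 * ‖w j‖ := by
  obtain ⟨ζ, hζ, rfl⟩ := hw
  have hj : ‖ζ j - 1‖ < 1 / 2 :=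
    (PiLp.norm_apply_le (ζ - ones ℂ n) j).trans_lt (mem_ball_iff_norm.1 hζ)
  have hsub := abs_le.1 ((abs_norm_sub_norm_le (ζ j) 1).trans hj.le)
  rw [norm_one] at hsub
  rw [coordMul_apply, norm_mul]
  constructor <;> nlinarith [norm_nonneg (z j)]

theorem norm_le_mul_norm_of_forall_apply {ι 𝕜 𝕜' : Type*} [Fintype ι] [RCLike 𝕜]
    [RCLike 𝕜'] {x : EuclideanSpace 𝕜 ι} {y : EuclideanSpace 𝕜' ι} {c : ℝ} (hc : 0 ≤ c)
    (h : ∀ j, ‖x j‖ ≤ c * ‖y j‖) : ‖x‖ ≤ c * ‖y‖ := by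
  refine le_of_sq_le_sq ?_ (by positivity)
  rw [mul_pow, EuclideanSpace.norm_sq_eq, EuclideanSpace.norm_sq_eq, Finset.mul_sum]
  gcongr with j
  rw [← mul_pow]
  gcongr
  exact h j

theorem norm_le_of_mem_mulBall (hw : w ∈ mulBall z) : ‖w‖ ≤ 2 * ‖z‖ ∧ ‖z‖ ≤ 2 * ‖w‖ :=
  ⟨norm_le_mul_norm_of_forall_apply zero_le_two fun j => (norm_apply_le_of_mem_mulBall hw j).1,
    norm_le_mul_norm_of_forall_apply zero_le_two fun j => (norm_apply_le_of_mem_mulBall hw j).2⟩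

theorem mulBall_subset_cstar (hz : z ∈ cstar n) : mulBall z ⊆ cstar n := fun w hw j => by
  have hj := norm_pos_iff.2 (hz j)
  exact norm_pos_iff.1 (by linarith [(norm_apply_le_of_mem_mulBall hw j).2])

theorem norm_Log_sub_Log_le_of_mem_mulBall (hz : z ∈ cstar n) (hw : w ∈ mulBall z) :
    ‖Log w - Log z‖ ≤ Real.log 2 * ‖ones ℝ n‖ := by
  have hlog {x y : ℝ} (hx : 0 < x) (hy : 0 < y) (h : x ≤ 2 * y) :
      Real.log x - Real.log y ≤ Real.log 2 := by
    rw [sub_le_iff_le_add, ← Real.log_mul two_ne_zero hy.ne']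
    exact Real.log_le_log hx h
  refine norm_le_mul_norm_of_forall_apply (Real.log_nonneg one_le_two) fun j => ?_
  have hzj := norm_pos_iff.2 (hz j)
  have hwj := norm_pos_iff.2 (mulBall_subset_cstar hz hw j)
  obtain ⟨h₁, h₂⟩ := norm_apply_le_of_mem_mulBall hw j
  simpa [ones, Log] using abs_sub_le_iff.2 ⟨hlog hwj hzj h₁, hlog hzj hwj h₂⟩

theorem measurableSet_mulBall (hz : z ∈ cstar n) : MeasurableSet (mulBall z) :=
  measurableSet_ball.image_of_continuousOn_injOn (coordMul z).continuous.continuousOn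
    (coordMul_injective hz).injOn

theorem setLIntegral_mulBall (hz : z ∈ cstar n) (g : EuclideanSpace ℂ (Fin n) → ℝ≥0∞) :
    ∫⁻ w in mulBall z, g w
      = ENNReal.ofReal (Real.exp (nu z)) ^ 2
        * ∫⁻ ζ in ball (ones ℂ n) (1 / 2), g (coordMul z ζ) := by
  rw [mulBall, lintegral_image_eq_lintegral_enorm_det_sq_mul volume measurableSet_ball
    (fun ζ _ => (coordMul z).hasFDerivWithinAt) (coordMul_injective hz).injOn,
    ← ofReal_norm, norm_det_coordMul hz, lintegral_const_mul' _ _ (by finiteness)]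

theorem enorm_sq_mul_volume_le_setLIntegral_mulBall {u : EuclideanSpace ℂ (Fin n) → ℂ}
    (hz : z ∈ cstar n) (hu : ∀ w ∈ mulBall z, DifferentiableAt ℂ u w) :
    ENNReal.ofReal (Real.exp (nu z)) ^ 2 * (‖u z‖ₑ ^ 2 * volume (ball (ones ℂ n) (1 / 2)))
      ≤ ∫⁻ w in mulBall z, ‖u w‖ₑ ^ 2 := by
  have hG : DifferentiableOn ℂ (u ∘ coordMul z) (ball (ones ℂ n) (1 / 2)) := fun ζ hζ =>
    ((hu _ (mem_image_of_mem _ hζ)).comp ζ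
      (coordMul z).differentiableAt).differentiableWithinAt
  rw [setLIntegral_mulBall hz]
  gcongr
  simpa only [Function.comp_apply, coordMul_ones] using
    enorm_sq_mul_measure_ball_le_lintegral volume hG

end MulBall

section Weight

theorem rpow_le_rpow_abs_mul_rpow {x y c : ℝ} (a : ℝ) (hx : 0 < x) (hy : 0 < y) (hc : 0 < c)
    (hxy : x ≤ c * y) (hyx : y ≤ c * x) : x ^ a ≤ c ^ |a| * y ^ a := by
  rcases le_total 0 a with ha | ha
  · rw [abs_of_nonneg ha, ← Real.mul_rpow hc.le hy.le]
    exact Real.rpow_le_rpow hx.le hxy ha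
  · rw [abs_of_nonpos ha, Real.rpow_neg hc.le, inv_mul_eq_div, le_div_iff₀' (by positivity),
      ← Real.mul_rpow hc.le hx.le]
    exact Real.rpow_le_rpow_of_nonpos hy hyx ha

/-- The weight `(1 + |z|²)^{-a} e^{-2mH_S(z) - 2ν(z)}` of the `L²` hypothesis. -/
noncomputable def weight (m a : ℝ) (S : Set (EuclideanSpace ℝ (Fin n)))
    (z : EuclideanSpace ℂ (Fin n)) : ℝ :=
  (1 + ‖z‖ ^ 2) ^ (-a) * Real.exp (-2 * m * logSuppFun S z - 2 * nu z)

/-- The function `(1 + |z|)^a e^{mH_S(z)}` that is to dominate `|u|` up to a constant. -/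
noncomputable def majorant (m a : ℝ) (S : Set (EuclideanSpace ℝ (Fin n)))
    (z : EuclideanSpace ℂ (Fin n)) : ℝ :=
  (1 + ‖z‖) ^ a * Real.exp (m * logSuppFun S z)

variable {S : Set (EuclideanSpace ℝ (Fin n))}

theorem majorant_pos (m a : ℝ) (S : Set (EuclideanSpace ℝ (Fin n)))
    (z : EuclideanSpace ℂ (Fin n)) : 0 < majorant m a S z := by
  unfold majorant
  positivity

theorem weight_nonneg (m a : ℝ) (S : Set (EuclideanSpace ℝ (Fin n)))
    (z : EuclideanSpace ℂ (Fin n)) : 0 ≤ weight m a S z := by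
  unfold weight
  positivity

theorem one_le_mul_majorant_sq_mul_weight (m a : ℝ) (S : Set (EuclideanSpace ℝ (Fin n)))
    (z : EuclideanSpace ℂ (Fin n)) :
    1 ≤ 2 ^ |a| * majorant m a S z ^ 2 * (weight m a S z * Real.exp (nu z) ^ 2) := by
  have hpow : (1 + ‖z‖ ^ 2) ^ a ≤ 2 ^ |a| * ((1 + ‖z‖) ^ a) ^ 2 := by
    rw [Real.rpow_pow_comm (by positivity)]
    exact rpow_le_rpow_abs_mul_rpow a (by positivity) (by positivity) two_pos
      (by nlinarith [norm_nonneg z]) (by nlinarith [sq_nonneg (1 - ‖z‖)])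
  have hexp : Real.exp (m * logSuppFun S z) ^ 2
      * (Real.exp (-2 * m * logSuppFun S z - 2 * nu z) * Real.exp (nu z) ^ 2) = 1 := by
    rw [← Real.exp_nat_mul, ← Real.exp_nat_mul, ← Real.exp_add, ← Real.exp_add,
      Real.exp_eq_one_iff]
    push_cast
    ring
  calc (1 : ℝ) = (1 + ‖z‖ ^ 2) ^ a * (1 + ‖z‖ ^ 2) ^ (-a) := by
        rw [← Real.rpow_add (by positivity), add_neg_cancel, Real.rpow_zero]
    _ ≤ 2 ^ |a| * ((1 + ‖z‖) ^ a) ^ 2 * (1 + ‖z‖ ^ 2) ^ (-a) := by gcongr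
    _ = 2 ^ |a| * ((1 + ‖z‖) ^ a) ^ 2 * (1 + ‖z‖ ^ 2) ^ (-a)
          * (Real.exp (m * logSuppFun S z) ^ 2
            * (Real.exp (-2 * m * logSuppFun S z - 2 * nu z) * Real.exp (nu z) ^ 2)) := by
        rw [hexp, mul_one]
    _ = 2 ^ |a| * majorant m a S z ^ 2 * (weight m a S z * Real.exp (nu z) ^ 2) := by
        rw [majorant, weight]
        ring

theorem exists_weight_le_mul_weight (m a : ℝ) (hS : Bornology.IsBounded S) :
    ∃ K : ℝ, 0 < K ∧ ∀ z ∈ cstar n, ∀ w ∈ mulBall z, weight m a S z ≤ K * weight m a S w := by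
  obtain ⟨M, hM⟩ : ∃ M : ℝ≥0, ∀ s ∈ S, ‖s‖ ≤ M := by
    obtain ⟨M, hM₀, hM⟩ := hS.exists_pos_norm_le
    exact ⟨⟨M, hM₀.le⟩, hM⟩
  let L := Real.log 2 * ‖ones ℝ n‖
  refine ⟨4 ^ |(-a)| * Real.exp (2 * |m| * (M * L) + 2 * (‖ones ℝ n‖ * L)), by positivity,
    fun z hz w hw => ?_⟩
  have hLog : ‖Log w - Log z‖ ≤ L := norm_Log_sub_Log_le_of_mem_mulBall hz hw
  have hpow : (1 + ‖z‖ ^ 2) ^ (-a) ≤ 4 ^ |(-a)| * (1 + ‖w‖ ^ 2) ^ (-a) := by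
    obtain ⟨hwz, hzw⟩ := norm_le_of_mem_mulBall hw
    exact rpow_le_rpow_abs_mul_rpow _ (by positivity) (by positivity) four_pos
      (by nlinarith [norm_nonneg z]) (by nlinarith [norm_nonneg w])
  have hH : m * (logSuppFun S w - logSuppFun S z) ≤ |m| * (M * L) := by
    rw [logSuppFun_of_mem_cstar hz, logSuppFun_of_mem_cstar (mulBall_subset_cstar hz hw)]
    refine (le_abs_self _).trans ?_
    rw [abs_mul]
    gcongr
    exact ((lipschitzWith_suppFun hM).norm_sub_le _ _).trans (by gcongr)
  have hν : nu w - nu z ≤ ‖ones ℝ n‖ * L := by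
    rw [nu, nu, ← inner_sub_right]
    exact (real_inner_le_norm _ _).trans (mul_le_mul_of_nonneg_left hLog (norm_nonneg _))
  have hexp : Real.exp (-2 * m * logSuppFun S z - 2 * nu z)
      ≤ Real.exp (2 * |m| * (M * L) + 2 * (‖ones ℝ n‖ * L))
        * Real.exp (-2 * m * logSuppFun S w - 2 * nu w) := by
    rw [← Real.exp_add, Real.exp_le_exp]
    linarith
  calc weight m a S z
      ≤ 4 ^ |(-a)| * (1 + ‖w‖ ^ 2) ^ (-a) *
        (Real.exp (2 * |m| * (M * L) + 2 * (‖ones ℝ n‖ * L))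
          * Real.exp (-2 * m * logSuppFun S w - 2 * nu w)) := by
        unfold weight
        gcongr
    _ = _ := by
        rw [weight]
        ring

end Weight

section Growth

variable {S : Set (EuclideanSpace ℝ (Fin n))} {u : EuclideanSpace ℂ (Fin n) → ℂ}

theorem ofReal_weight_mul_setLIntegral_mulBall_le {m a K : ℝ} {z : EuclideanSpace ℂ (Fin n)}
    (hz : z ∈ cstar n) (hK : 0 ≤ K) (h : ∀ w ∈ mulBall z, weight m a S z ≤ K * weight m a S w) :
    ENNReal.ofReal (weight m a S z) * ∫⁻ w in mulBall z, ‖u w‖ₑ ^ 2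
      ≤ ENNReal.ofReal K * ∫⁻ w, ‖u w‖ₑ ^ 2 * ENNReal.ofReal (weight m a S w) :=
  calc ENNReal.ofReal (weight m a S z) * ∫⁻ w in mulBall z, ‖u w‖ₑ ^ 2
      = ∫⁻ w in mulBall z, ENNReal.ofReal (weight m a S z) * ‖u w‖ₑ ^ 2 :=
        (lintegral_const_mul' _ _ ENNReal.ofReal_ne_top).symm
    _ ≤ ∫⁻ w in mulBall z,
          ENNReal.ofReal K * (‖u w‖ₑ ^ 2 * ENNReal.ofReal (weight m a S w)) := by
        refine setLIntegral_mono' (measurableSet_mulBall hz) fun w hw => ?_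
        rw [mul_left_comm, mul_comm, ← ENNReal.ofReal_mul hK]
        gcongr
        exact h w hw
    _ = ENNReal.ofReal K * ∫⁻ w in mulBall z, ‖u w‖ₑ ^ 2 * ENNReal.ofReal (weight m a S w) :=
        lintegral_const_mul' _ _ ENNReal.ofReal_ne_top
    _ ≤ ENNReal.ofReal K * ∫⁻ w, ‖u w‖ₑ ^ 2 * ENNReal.ofReal (weight m a S w) := by
        gcongr
        exact Measure.restrict_le_self

theorem exists_weight_mul_exp_nu_sq_mul_norm_sq_le {m a : ℝ} (hS : Bornology.IsBounded S)
    (hint : ∫⁻ w, ‖u w‖ₑ ^ 2 * ENNReal.ofReal (weight m a S w) ≠ ∞) :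
    ∃ A : ℝ, 0 ≤ A ∧ ∀ z ∈ cstar n, (∀ w ∈ mulBall z, DifferentiableAt ℂ u w) →
      weight m a S z * Real.exp (nu z) ^ 2 * ‖u z‖ ^ 2 ≤ A := by
  obtain ⟨K, hK, hweight⟩ := exists_weight_le_mul_weight m a hS
  let I := ∫⁻ w, ‖u w‖ₑ ^ 2 * ENNReal.ofReal (weight m a S w)
  let B := ball (ones ℂ n) (1 / 2)
  have hB : 0 < volume.real B :=
    ENNReal.toReal_pos (measure_ball_pos _ _ (by norm_num)).ne' measure_ball_lt_top.ne
  refine ⟨K * I.toReal / volume.real B, by positivity, fun z hz hu => ?_⟩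
  have hmean : ENNReal.ofReal (weight m a S z)
      * (ENNReal.ofReal (Real.exp (nu z)) ^ 2 * (‖u z‖ₑ ^ 2 * volume B))
        ≤ ENNReal.ofReal K * I :=
    (mul_le_mul_right (enorm_sq_mul_volume_le_setLIntegral_mulBall hz hu) _).trans
      (ofReal_weight_mul_setLIntegral_mulBall_le hz hK.le (hweight z hz))
  have hreal := ENNReal.toReal_mono (ENNReal.mul_ne_top ENNReal.ofReal_ne_top hint) hmean
  simp only [ENNReal.toReal_mul, ENNReal.toReal_pow, toReal_enorm, ← measureReal_def,
    ENNReal.toReal_ofReal, weight_nonneg, Real.exp_nonneg, hK.le] at hreal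
  rw [le_div_iff₀ hB]
  linarith

theorem exists_norm_le_mul_majorant_of_differentiableAt_mulBall {m a : ℝ}
    (hS : Bornology.IsBounded S)
    (hint : ∫⁻ w, ‖u w‖ₑ ^ 2 * ENNReal.ofReal (weight m a S w) ≠ ∞) :
    ∃ C : ℝ, ∀ z ∈ cstar n, (∀ w ∈ mulBall z, DifferentiableAt ℂ u w) →
      ‖u z‖ ≤ C * majorant m a S z := by
  obtain ⟨A, hA₀, hA⟩ := exists_weight_mul_exp_nu_sq_mul_norm_sq_le hS hint
  refine ⟨√(2 ^ |a| * A), fun z hz hu => ?_⟩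
  refine le_of_sq_le_sq ?_ (mul_nonneg (Real.sqrt_nonneg _) (majorant_pos m a S z).le)
  rw [mul_pow, Real.sq_sqrt (by positivity)]
  calc ‖u z‖ ^ 2
      ≤ 2 ^ |a| * majorant m a S z ^ 2 * (weight m a S z * Real.exp (nu z) ^ 2) * ‖u z‖ ^ 2 :=
        le_mul_of_one_le_left (sq_nonneg _) (one_le_mul_majorant_sq_mul_weight m a S z)
    _ = 2 ^ |a| * majorant m a S z ^ 2
          * (weight m a S z * Real.exp (nu z) ^ 2 * ‖u z‖ ^ 2) := by ring
    _ ≤ 2 ^ |a| * majorant m a S z ^ 2 * A := by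
        gcongr
        exact hA z hz hu
    _ = 2 ^ |a| * A * majorant m a S z ^ 2 := by ring

theorem exists_norm_le_mul_majorant_of_norm_le (m a : ℝ) (hS : Bornology.IsBounded S)
    (hS₀ : ∀ s ∈ S, ∀ j, 0 ≤ s j) (h₀ : 0 ∈ S) (hu : Continuous u) (R : ℝ) :
    ∃ C : ℝ, ∀ z ∈ cstar n, ‖z‖ ≤ R → ‖u z‖ ≤ C * majorant m a S z := by
  have hpos (z : EuclideanSpace ℂ (Fin n)) : 0 < (1 + ‖z‖) ^ a := by positivity
  have hpow : Continuous fun z : EuclideanSpace ℂ (Fin n) => (1 + ‖z‖) ^ a :=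
    Continuous.rpow_const (by fun_prop) fun z => Or.inl (by positivity)
  have hcont : Continuous fun z => ‖u z‖ / (1 + ‖z‖) ^ a := hu.norm.div hpow fun z => (hpos z).ne'
  obtain ⟨C, hC⟩ := (isCompact_closedBall 0 R).exists_bound_of_continuousOn hcont.continuousOn
  let H := suppFun S (WithLp.toLp 2 fun _ => Real.log R)
  refine ⟨C * Real.exp (|m| * H), fun z hz hzR => ?_⟩
  have hH : -(m * logSuppFun S z) ≤ |m| * H := by
    rw [logSuppFun_of_mem_cstar hz, ← neg_mul]
    exact mul_le_mul (neg_le_abs m) (suppFun_Log_le_of_norm_le hS hS₀ hz hzR)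
      (suppFun_nonneg hS h₀ _) (abs_nonneg m)
  have hCz : ‖u z‖ ≤ C * (1 + ‖z‖) ^ a := by
    have h := hC z (mem_closedBall_zero_iff.2 hzR)
    rwa [norm_div, norm_norm, Real.norm_of_nonneg (hpos z).le, div_le_iff₀ (hpos z)] at h
  calc ‖u z‖ ≤ C * (1 + ‖z‖) ^ a * Real.exp (|m| * H + m * logSuppFun S z) :=
        hCz.trans (le_mul_of_one_le_right ((norm_nonneg _).trans hCz)
          (Real.one_le_exp (by linarith)))
    _ = C * Real.exp (|m| * H) * majorant m a S z := by
        rw [majorant, Real.exp_add]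
        ring

theorem norm_le_mul_majorant_of_forall_mem_cstar {m a C : ℝ} (hS : Bornology.IsBounded S)
    (hS₀ : ∀ s ∈ S, ∀ j, 0 ≤ s j) (h₀ : 0 ∈ S) (hu : Continuous u)
    (h : ∀ z ∈ cstar n, ‖u z‖ ≤ C * majorant m a S z) (z : EuclideanSpace ℂ (Fin n)) :
    ‖u z‖ ≤ C * majorant m a S z := by
  obtain ⟨U, hUz, hUH⟩ := mapClusterPt_iff_ultrafilter.1 (mapClusterPt_logSuppFun hS hS₀ h₀ z)
  have hUid : Tendsto id (U : Filter (EuclideanSpace ℂ (Fin n))) (𝓝 z) :=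
    hUz.trans nhdsWithin_le_nhds
  refine le_of_tendsto_of_tendsto (hu.norm.continuousAt.tendsto.comp hUid)
    ((((tendsto_const_nhds.add hUid.norm).rpow_const (Or.inl (by positivity))).mul
      (hUH.const_mul m).rexp).const_mul C) ?_
  filter_upwards [hUz self_mem_nhdsWithin] with w hw
  simpa only [majorant, logSuppFun_of_mem_cstar hw, Function.comp_apply, id_eq] using h w hw

end Growth

end LogSupport

open LogSupport in
theorem proposition5p2_general {n : ℕ} (m a : ℝ) {S : Set (EuclideanSpace ℝ (Fin n))}
    (hS_bounded : Bornology.IsBounded S) (hS_nonneg : ∀ s ∈ S, ∀ j, 0 ≤ s j)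
    (hS_zero : (0 : EuclideanSpace ℝ (Fin n)) ∈ S)
    {u : EuclideanSpace ℂ (Fin n) → ℂ} (hu : Continuous u)
    (hol : ∀ᶠ z in cocompact (EuclideanSpace ℂ (Fin n)), DifferentiableAt ℂ u z)
    (hint : ∫⁻ z, ENNReal.ofReal (‖u z‖ ^ 2 * (1 + ‖z‖ ^ 2) ^ (-a)
      * Real.exp (-2 * m * logSuppFun S z - 2 * nu z)) < ⊤) :
    ∃ C : ℝ, 0 < C ∧ ∀ z, ‖u z‖ ≤ C * (1 + ‖z‖) ^ a * Real.exp (m * logSuppFun S z) := by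
  have hweight : ∫⁻ z, ‖u z‖ₑ ^ 2 * ENNReal.ofReal (weight m a S z) ≠ ∞ := by
    simpa only [weight, mul_assoc, ENNReal.ofReal_mul (sq_nonneg _),
      ENNReal.ofReal_pow (norm_nonneg _), ofReal_norm] using hint.ne
  obtain ⟨R, hR⟩ : ∃ R : ℝ, ∀ z, R ≤ ‖z‖ → DifferentiableAt ℂ u z := by
    rw [← cobounded_eq_cocompact, hasBasis_cobounded_norm.eventually_iff] at hol
    simpa using hol
  obtain ⟨C₁, hC₁⟩ :=
    exists_norm_le_mul_majorant_of_norm_le m a hS_bounded hS_nonneg hS_zero hu (2 * R)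
  obtain ⟨C₂, hC₂⟩ :=
    exists_norm_le_mul_majorant_of_differentiableAt_mulBall hS_bounded hweight
  have hcstar (z) (hz : z ∈ cstar n) : ‖u z‖ ≤ max 1 (max C₁ C₂) * majorant m a S z := by
    have hpos := majorant_pos m a S z
    rcases le_or_gt ‖z‖ (2 * R) with hzR | hzR
    · exact (hC₁ z hz hzR).trans (by gcongr; simp)
    · refine (hC₂ z hz fun w hw => hR w ?_).trans (by gcongr; simp)
      linarith [(norm_le_of_mem_mulBall hw).2]
  refine ⟨max 1 (max C₁ C₂), by positivity, fun z => ?_⟩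
  simpa only [majorant, mul_assoc] using
    norm_le_mul_majorant_of_forall_mem_cstar hS_bounded hS_nonneg hS_zero hu hcstar z

theorem proposition5p2 (n m : ℕ) (a : ℝ)
    (S : Set (EuclideanSpace ℝ (Fin n)))
    (hS_compact : IsCompact S) (hS_convex : Convex ℝ S)
    (hS_nonneg : ∀ s ∈ S, ∀ j, 0 ≤ s j) (hS_zero : (0 : EuclideanSpace ℝ (Fin n)) ∈ S)
    (u : EuclideanSpace ℂ (Fin n) → ℂ) (hu : ContDiff ℝ 1 u)
    (hdbar : HasCompactSupport (LogSupport.dbar u))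
    (hint : ∫⁻ z : EuclideanSpace ℂ (Fin n),
        ENNReal.ofReal (‖u z‖ ^ 2 * (1 + ‖z‖ ^ 2) ^ (-a)
          * Real.exp (-2 * m * LogSupport.logSuppFun S z - 2 * LogSupport.nu z)) < ⊤) :
    ∃ C : ℝ, 0 < C ∧ ∀ z : EuclideanSpace ℂ (Fin n),
      ‖u z‖ ≤ C * (1 + ‖z‖) ^ a * Real.exp (m * LogSupport.logSuppFun S z) :=
  proposition5p2_general m a hS_compact.isBounded hS_nonneg hS_zero hu.continuous
    (LogSupport.eventually_differentiableAt_of_hasCompactSupport_dbar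
      (hu.differentiable one_ne_zero) hdbar) hint
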